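/- Let $\mu$ be a measure on $\mathbb{R}$ and $p_0$ a probability density with respect to $\mu$. Put $\kappa(\theta)=\log\int e^{\theta x}p_0(x)\,d\mu(x)$, $p_\theta(x)=e^{\theta x-\kappa(\theta)}p_0(x)$ and, for a probability measure $g$ on $\mathbb{R}$, $f_g(x)=\int p_\theta(x)\,dg(\theta)$. For densities $f,f_0$ with respect to $\mu$ let $H^2(f,f_0)=\int(\sqrt f-\sqrt{f_0})^2\,d\mu$. Assume (S2): $\int e^{\theta x}p_0(x)\,d\mu(x)<\infty$ for every $\theta\in\mathbb{R}$, $\int x\,p_0(x)\,d\mu(x)=0$, and there are exponents $\alpha_1\ge\alpha_2>0$ and constants $c_0,c_1,c_2>0$ with $$c_1|\theta|^{1+1/\alpha_1}\le\kappa(\theta),\qquad \kappa''(\theta)\le c_2|\theta|^{1/\alpha_2-1}\qquad\text{for all }|\theta|\ge c_0 .$$ Let $g_0$ be a probability measure on $\mathbb{R}$. For each $n$ let $X_1,\dots,X_n$ be i.i.d. with density $f_{g_0}$ with respect to $\mu$, and write $|X|_n=\max_{1\le i\le n}|X_i|$ and $\ell_n(f)=\sum_{i=1}^n\log f(X_i)$.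 Assume (LT): there are $\beta_0,b_0,b_1>0$ such that $\mathbb{P}(|X|_n\ge t)\le n\exp(-b_1t^{\beta_0})$ for all $n$ and all $t\ge b_0$. Put $a\wedge b=\min\{a,b\}$, $a\vee b=\max\{a,b\}$ and $$\gamma_0=\frac{\alpha_1}{2\beta_0}\Bigl(1+\frac1{\alpha_2\wedge1}\Bigr)+2\Bigl(\frac{1+\alpha_1}{\beta_0}\vee1\Bigr),\qquad \gamma_1=\Bigl(\frac{\beta_0}{\max\{4(1+\alpha_1),\ \alpha_1+\alpha_1/(\alpha_2\wedge1)\}}\Bigr)\wedge1 .$$ Let $A_1,A_2>0$. Then there is a constant $C>0$, depending only on $p_0$ (with $\mu$), $g_0$, $A_1$, $A_2$ (and the exponents $\alpha_1,\alpha_2,\beta_0$), such that the following holds for every $n\ge C$. Let $\tilde g$ be a random probability measure on $\mathbb{R}$ such that, almost surely, $$\ell_n(f_{\hat g})-\ell_n(f_{\tilde g})\le A_1(\log n)^{\gamma_0}\qquad\text{and}\qquad \sup_{\theta\in\mathrm{supp}(\tilde g)}|\theta|\le A_2|X|_n^{\alpha_1},$$ where $\hat g$ is a nonparametric maximum likelihood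 estimator, that is, a maximizer of $g\mapsto\ell_n(f_g)$ over all probability measures $g$ on $\mathbb{R}$. Then, for all $t\ge1$, $$\mathbb{P}\Bigl(H^2(f_{\tilde g},f_{g_0})\ge t\,C\,\frac{(\log n)^{\gamma_0}}{n}\Bigr)\le 3\exp\bigl(-t^{\gamma_1}\log n\bigr).$$ -/

import Mathlib

open MeasureTheory ProbabilityTheory

noncomputable section

/-- `f` is a (measurable, real-valued) probability density with respect to `μ`. -/
structure IsProbDensity (μ : Measure ℝ) (f : ℝ → ℝ) : Prop where
  measurable : Measurable f
  nonneg : ∀ x, 0 ≤ f x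
  lintegral_eq_one : ∫⁻ x, ENNReal.ofReal (f x) ∂μ = 1

/-- The measure `f(x) μ(dx)`. -/
def densityMeasure (μ : Measure ℝ) (f : ℝ → ℝ) : Measure ℝ :=
  μ.withDensity fun x => ENNReal.ofReal (f x)

/-- The canonical parameter space `Θ = {θ : ∫ exp (θ x) p₀(x) dμ(x) < ∞}`. -/
def canonicalSpace (μ : Measure ℝ) (p₀ : ℝ → ℝ) : Set ℝ :=
  integrableExpSet id (densityMeasure μ p₀)

/-- The cumulant generating function `κ(θ) = log ∫ exp (θ x) p₀(x) dμ(x)`. -/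
def cumulant (μ : Measure ℝ) (p₀ : ℝ → ℝ) (θ : ℝ) : ℝ :=
  cgf id (densityMeasure μ p₀) θ

/-- The member `p_θ(x) = exp (θ x - κ(θ)) p₀(x)` of the exponential family. -/
def expFamily (μ : Measure ℝ) (p₀ : ℝ → ℝ) (θ x : ℝ) : ℝ :=
  Real.exp (θ * x - cumulant μ p₀ θ) * p₀ x

/-- The mixture density `f_g(x) = ∫ p_θ(x) dg(θ)`. -/
def mixtureDensity (μ : Measure ℝ) (p₀ : ℝ → ℝ) (g : ProbabilityMeasure ℝ) (x : ℝ) : ℝ :=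
  ∫ θ, expFamily μ p₀ θ x ∂(g : Measure ℝ)

/-- The squared Hellinger distance `∫ (√f - √f₀)² dμ`. -/
def hellingerSq (μ : Measure ℝ) (f f₀ : ℝ → ℝ) : ℝ :=
  ∫ x, (√(f x) - √(f₀ x)) ^ 2 ∂μ

/-- `|x|_n`, the largest absolute value in the sample `x₁, …, x_n`. -/
def maxAbs {n : ℕ} (x : Fin n → ℝ) : ℝ :=
  ⨆ i, |x i|

/-- The log-likelihood `ℓ_n(f) = ∑ log f(x_i)`. -/
def logLik {n : ℕ} (x : Fin n → ℝ) (f : ℝ → ℝ) : ℝ :=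
  ∑ i, Real.log (f (x i))

/-- `g` is a nonparametric maximum likelihood estimator for the sample `x`, when the mixing
distributions range over all probability measures on the line (`Θ₀ = ℝ`). -/
def IsNPMLE (μ : Measure ℝ) (p₀ : ℝ → ℝ) {n : ℕ} (x : Fin n → ℝ)
    (g : ProbabilityMeasure ℝ) : Prop :=
  ∀ h : ProbabilityMeasure ℝ, logLik x (mixtureDensity μ p₀ h) ≤ logLik x (mixtureDensity μ p₀ g)

/-- `g` is an approximate NPMLE with tolerance `Δ`: `ℓ_n(f_ĝ) - ℓ_n(f_g) ≤ Δ`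
for an NPMLE `ĝ`. -/
def IsApproxNPMLE (μ : Measure ℝ) (p₀ : ℝ → ℝ) {n : ℕ} (x : Fin n → ℝ) (Δ : ℝ)
    (g : ProbabilityMeasure ℝ) : Prop :=
  ∃ ĝ : ProbabilityMeasure ℝ, IsNPMLE μ p₀ x ĝ ∧
    logLik x (mixtureDensity μ p₀ ĝ) - logLik x (mixtureDensity μ p₀ g) ≤ Δ

/-- The exponential family generated by the base density `p₀`, with unrestricted parameter set
`Θ₀ = Θ = ℝ`, mean zero base density, and the two tail conditions on `κ` with exponents
`α₁ ≥ α₂ > 0`. -/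
structure ScenarioS2 (μ : Measure ℝ) (p₀ : ℝ → ℝ) (α₁ α₂ : ℝ) : Prop where
  density : IsProbDensity μ p₀
  canonicalSpace_eq : canonicalSpace μ p₀ = Set.univ
  mean_zero : ∫ x, x * p₀ x ∂μ = 0
  alpha₂_pos : 0 < α₂
  alpha₂_le : α₂ ≤ α₁
  growth : ∃ c₀ c₁ c₂ : ℝ, 0 < c₀ ∧ 0 < c₁ ∧ 0 < c₂ ∧ ∀ θ : ℝ, c₀ ≤ |θ| →
    c₁ * |θ| ^ (1 + 1 / α₁) ≤ cumulant μ p₀ θ ∧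
    iteratedDeriv 2 (cumulant μ p₀) θ ≤ c₂ * |θ| ^ (1 / α₂ - 1)

/-- The light-tail condition with exponent `β₀`: for every `n`, the maximum `|X|_n` of `n` i.i.d.
observations from `f_{g₀}` satisfies `ℙ(|X|_n ≥ t) ≤ n exp (-b₁ t ^ β₀)` for `t ≥ b₀`. -/
def LightTail (μ : Measure ℝ) (p₀ : ℝ → ℝ) (g₀ : ProbabilityMeasure ℝ) (β₀ : ℝ) : Prop :=
  0 < β₀ ∧ ∃ b₀ b₁ : ℝ, 0 < b₀ ∧ 0 < b₁ ∧ ∀ (n : ℕ) (t : ℝ), b₀ ≤ t →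
    (Measure.pi fun _ : Fin n => densityMeasure μ (mixtureDensity μ p₀ g₀)).real
        {x | t ≤ maxAbs x} ≤ n * Real.exp (-b₁ * t ^ β₀)

/-- The rate exponent `γ₀`. -/
def gammaZero (α₁ α₂ β₀ : ℝ) : ℝ :=
  α₁ / (2 * β₀) * (1 + 1 / min α₂ 1) + 2 * max ((1 + α₁) / β₀) 1

/-- The tail exponent `γ₁`. -/
def gammaOne (α₁ α₂ β₀ : ℝ) : ℝ :=
  min (β₀ / max (4 * (1 + α₁)) (α₁ + α₁ / min α₂ 1)) 1

end

/-! ### Exponential family mixtures -/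

section ExponentialFamily

variable {μ : Measure ℝ} {p₀ : ℝ → ℝ}

/-! Truncation reduces the claim to a finite union bound. Let `L = log n` and `s = t ^ γ₁`. The
light tail gives `|X|_n ≤ M` with `M` of order `(s L) ^ (1 / β₀)`, off an event of probability `exp
(-s L)`; then the mixing measure lives on `[-T, T]`, `T = A₂ M ^ α₁`.

For such `g`, `f_g / p₀` is a Laplace transform of `exp (-κ) dg`. Mean zero forces `κ ≥ 0`, so on
`[-M, M]` it is determined up to `η` by order `M T + log (1 / η)` scaled moments in `[-1, 1]`.
Rounding them splits the mixing measures into `exp (O((M T + log (1 / η) + 1) ^ 2))` cells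
(`exists_finite_coloring`).

In each cell containing some `g'` at squared Hellinger distance at least `E`, every `f_g` is at most
`f_g' + η p₀` on the sample. Markov's inequality for the square root of the likelihood ratio
(`measure_likelihood_le`) bounds the cell by `exp (Δ / 2 + n √η - n E / 2)`. With `η = n ^ (-2)`,
summing over cells gives `measure_hellinger_deviation_le`. Since `M T` is at most of order `√t L ^
m` with `2 m ≤ γ₀`, the entropy is absorbed by `n E = t C L ^ γ₀`. -/

/-- The likelihood ratio `f_g / p₀`. -/
noncomputable def mixtureRatio (μ : Measure ℝ) (p₀ : ℝ → ℝ) (g : ProbabilityMeasure ℝ) (x : ℝ) : ℝ :=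
  ∫ θ, Real.exp (θ * x - cumulant μ p₀ θ) ∂(g : Measure ℝ)

lemma mixtureDensity_eq (g : ProbabilityMeasure ℝ) (x : ℝ) :
    mixtureDensity μ p₀ g x = mixtureRatio μ p₀ g x * p₀ x := by
  simp only [mixtureDensity, mixtureRatio, expFamily]
  exact integral_mul_const _ _

lemma mixtureRatio_nonneg (g : ProbabilityMeasure ℝ) (x : ℝ) : 0 ≤ mixtureRatio μ p₀ g x :=
  integral_nonneg fun _ => (Real.exp_pos _).le

lemma IsProbDensity.isProbabilityMeasure (h : IsProbDensity μ p₀) :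
    IsProbabilityMeasure (densityMeasure μ p₀) := by
  constructor
  rw [densityMeasure, withDensity_apply _ MeasurableSet.univ, Measure.restrict_univ,
    h.lintegral_eq_one]

lemma mixtureDensity_nonneg (h : IsProbDensity μ p₀) (g : ProbabilityMeasure ℝ) (x : ℝ) :
    0 ≤ mixtureDensity μ p₀ g x := by
  rw [mixtureDensity_eq]
  exact mul_nonneg (mixtureRatio_nonneg g x) (h.nonneg x)

lemma integrable_exp_mul_of_canonicalSpace (h : canonicalSpace μ p₀ = Set.univ) (θ : ℝ) :
    Integrable (fun x => Real.exp (θ * id x)) (densityMeasure μ p₀) := by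
  have : θ ∈ canonicalSpace μ p₀ := h ▸ Set.mem_univ θ
  exact this

lemma cumulant_measurable (h : canonicalSpace μ p₀ = Set.univ) :
    Measurable (cumulant μ p₀) := by
  unfold cumulant
  exact Real.measurable_log.comp
    (continuous_mgf (integrable_exp_mul_of_canonicalSpace h)).measurable

lemma exp_cumulant (hd : IsProbDensity μ p₀) (h : canonicalSpace μ p₀ = Set.univ) (θ : ℝ) :
    Real.exp (cumulant μ p₀ θ) = ∫ x, Real.exp (θ * x) ∂(densityMeasure μ p₀) := by
  have := hd.isProbabilityMeasure
  exact exp_cgf (integrable_exp_mul_of_canonicalSpace h θ)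

lemma integrable_id_densityMeasure (h : canonicalSpace μ p₀ = Set.univ) :
    Integrable (fun x : ℝ => x) (densityMeasure μ p₀) := by
  have : (0 : ℝ) ∈ interior (integrableExpSet id (densityMeasure μ p₀)) := by
    have h' : integrableExpSet id (densityMeasure μ p₀) = Set.univ := h
    rw [h']; simp
  simpa using integrable_pow_of_mem_interior_integrableExpSet this 1

/-- Integrate `exp y ≥ 1 + y` at `y = θ x`; the linear term has mean zero. This is what bounds the
weights `exp (-κ)` by one. -/
lemma cumulant_nonneg (hd : IsProbDensity μ p₀) (h : canonicalSpace μ p₀ = Set.univ)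
    (h0 : ∫ x, x * p₀ x ∂μ = 0) (θ : ℝ) : 0 ≤ cumulant μ p₀ θ := by
  have := hd.isProbabilityMeasure
  have hmean : ∫ x, x ∂(densityMeasure μ p₀) = 0 := by
    rw [densityMeasure, integral_withDensity_eq_integral_toReal_smul
      hd.measurable.ennreal_ofReal (by simp), ← h0]
    refine integral_congr_ae (.of_forall fun x => ?_)
    simp [ENNReal.toReal_ofReal (hd.nonneg x), mul_comm]
  have hi := integrable_id_densityMeasure h
  rw [← Real.one_le_exp_iff, exp_cumulant hd h]
  calc (1 : ℝ) = ∫ x, (θ * x + 1) ∂(densityMeasure μ p₀) := by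
        rw [integral_add (hi.const_mul θ) (integrable_const _), integral_const_mul, hmean]
        simp
    _ ≤ _ := integral_mono ((hi.const_mul θ).add (integrable_const _))
        (integrable_exp_mul_of_canonicalSpace h θ) fun x => Real.add_one_le_exp _

lemma measurable_exp_sub_cumulant (h : canonicalSpace μ p₀ = Set.univ) :
    Measurable fun z : ℝ × ℝ => Real.exp (z.2 * z.1 - cumulant μ p₀ z.2) :=
  Real.measurable_exp.comp ((measurable_snd.mul measurable_fst).sub
    ((cumulant_measurable h).comp measurable_snd))

lemma mixtureRatio_measurable (h : canonicalSpace μ p₀ = Set.univ) (g : ProbabilityMeasure ℝ) :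
    Measurable (mixtureRatio μ p₀ g) :=
  (StronglyMeasurable.integral_prod_right'
    (measurable_exp_sub_cumulant h).stronglyMeasurable).measurable

lemma mixtureDensity_measurable (hd : IsProbDensity μ p₀) (h : canonicalSpace μ p₀ = Set.univ)
    (g : ProbabilityMeasure ℝ) : Measurable (mixtureDensity μ p₀ g) := by
  have : mixtureDensity μ p₀ g = fun x => mixtureRatio μ p₀ g x * p₀ x :=
    funext (mixtureDensity_eq g)
  rw [this]
  exact (mixtureRatio_measurable h g).mul hd.measurable

/-- Tonelli. Settling for an inequality avoids proving that the inner integral over `θ` is finite.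
-/
lemma lintegral_mixtureDensity_le_one (hd : IsProbDensity μ p₀)
    (h : canonicalSpace μ p₀ = Set.univ) (g : ProbabilityMeasure ℝ) :
    ∫⁻ x, ENNReal.ofReal (mixtureDensity μ p₀ g x) ∂μ ≤ 1 := by
  have := hd.isProbabilityMeasure
  calc ∫⁻ x, ENNReal.ofReal (mixtureDensity μ p₀ g x) ∂μ
      = ∫⁻ x, ENNReal.ofReal (mixtureRatio μ p₀ g x) ∂(densityMeasure μ p₀) := by
        rw [densityMeasure, lintegral_withDensity_eq_lintegral_mul _ hd.measurable.ennreal_ofReal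
          (mixtureRatio_measurable h g).ennreal_ofReal]
        refine lintegral_congr fun x => ?_
        rw [mixtureDensity_eq, Pi.mul_apply, mul_comm, ENNReal.ofReal_mul (hd.nonneg x)]
    _ ≤ ∫⁻ x, ∫⁻ θ, ENNReal.ofReal (Real.exp (θ * x - cumulant μ p₀ θ)) ∂(g : Measure ℝ)
          ∂(densityMeasure μ p₀) := by
        refine lintegral_mono fun x => ?_
        rw [mixtureRatio, integral_eq_lintegral_of_nonneg_ae
          (.of_forall fun _ => (Real.exp_pos _).le)
          ((measurable_exp_sub_cumulant h).comp measurable_prodMk_left).aestronglyMeasurable]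
        exact ENNReal.ofReal_toReal_le
    _ = ∫⁻ θ, ∫⁻ x, ENNReal.ofReal (Real.exp (θ * x - cumulant μ p₀ θ)) ∂(densityMeasure μ p₀)
          ∂(g : Measure ℝ) :=
        lintegral_lintegral_swap (measurable_exp_sub_cumulant h).ennreal_ofReal.aemeasurable
    _ = ∫⁻ _, 1 ∂(g : Measure ℝ) := by
        refine lintegral_congr fun θ => ?_
        rw [← ofReal_integral_eq_lintegral_ofReal _ (.of_forall fun _ => (Real.exp_pos _).le)]
        · simp_rw [Real.exp_sub, integral_div]
          rw [← exp_cumulant hd h, div_self (Real.exp_pos _).ne', ENNReal.ofReal_one]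
        · simp_rw [Real.exp_sub]
          exact (integrable_exp_mul_of_canonicalSpace h θ).div_const _
    _ = 1 := by simp

end ExponentialFamily

/-! ### Hellinger affinity -/

section Hellinger

variable {μ : Measure ℝ} {f f₀ : ℝ → ℝ}

lemma hellingerSq_nonneg (μ : Measure ℝ) (f f₀ : ℝ → ℝ) : 0 ≤ hellingerSq μ f f₀ :=
  integral_nonneg fun _ => sq_nonneg _

lemma lintegral_sqrt_mul_le (hf : Measurable f) (hf₀ : Measurable f₀) (hfn : ∀ x, 0 ≤ f x)
    (hf₀n : ∀ x, 0 ≤ f₀ x) (h1 : ∫⁻ x, ENNReal.ofReal (f x) ∂μ ≤ 1)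
    (h2 : ∫⁻ x, ENNReal.ofReal (f₀ x) ∂μ ≤ 1) :
    ∫⁻ x, ENNReal.ofReal (√(f x * f₀ x)) ∂μ ≤ ENNReal.ofReal (1 - hellingerSq μ f f₀ / 2) ∧
      hellingerSq μ f f₀ ≤ 2 := by
  have key : ∀ {f : ℝ → ℝ}, Measurable f → (∀ x, 0 ≤ f x) →
      ∫⁻ x, ENNReal.ofReal (f x) ∂μ ≤ 1 → Integrable f μ ∧ ∫ x, f x ∂μ ≤ 1 := by
    intro f hf hn h
    have hi : Integrable f μ := ⟨hf.aestronglyMeasurable, by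
      rw [hasFiniteIntegral_iff_ofReal (.of_forall hn)]
      exact h.trans_lt ENNReal.one_lt_top⟩
    refine ⟨hi, ?_⟩
    rw [integral_eq_lintegral_of_nonneg_ae (.of_forall hn) hf.aestronglyMeasurable]
    exact ENNReal.toReal_le_of_le_ofReal zero_le_one (by simpa using h)
  obtain ⟨i1, l1⟩ := key hf hfn h1
  obtain ⟨i2, l2⟩ := key hf₀ hf₀n h2
  have i3 : Integrable (fun x => √(f x * f₀ x)) μ := by
    refine (i1.add i2).mono' (hf.mul hf₀).sqrt.aestronglyMeasurable (.of_forall fun x => ?_)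
    rw [Real.norm_of_nonneg (Real.sqrt_nonneg _)]
    refine Real.sqrt_le_iff.2 ⟨add_nonneg (hfn x) (hf₀n x), ?_⟩
    simp only [Pi.add_apply]
    nlinarith [hfn x, hf₀n x, mul_nonneg (hfn x) (hf₀n x)]
  have hH : hellingerSq μ f f₀ = ∫ x, f x ∂μ + ∫ x, f₀ x ∂μ - 2 * ∫ x, √(f x * f₀ x) ∂μ := by
    have i4 : Integrable (fun x => f x + f₀ x) μ := i1.add i2
    rw [← integral_add i1 i2, ← integral_const_mul, ← integral_sub i4 (i3.const_mul 2)]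
    refine integral_congr_ae (.of_forall fun x => ?_)
    simp only
    rw [Real.sqrt_mul (hfn x), sub_sq, Real.sq_sqrt (hfn x), Real.sq_sqrt (hf₀n x)]
    ring
  rw [← ofReal_integral_eq_lintegral_ofReal i3 (.of_forall fun _ => Real.sqrt_nonneg _)]
  have hpos : 0 ≤ ∫ x, √(f x * f₀ x) ∂μ := integral_nonneg fun _ => Real.sqrt_nonneg _
  exact ⟨ENNReal.ofReal_le_ofReal (by linarith), by linarith⟩

lemma sqrt_add_le_add_sqrt {a b : ℝ} (ha : 0 ≤ a) (hb : 0 ≤ b) : √(a + b) ≤ √a + √b := by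
  refine Real.sqrt_le_iff.2 ⟨by positivity, ?_⟩
  nlinarith [Real.sq_sqrt ha, Real.sq_sqrt hb, Real.sqrt_nonneg a, Real.sqrt_nonneg b]

/-- Subadditivity of the square root: the perturbation `η p₀` costs `√η` times an affinity that is
at most one. -/
lemma lintegral_sqrt_add_mul_le {p₀ : ℝ → ℝ} (hp : IsProbDensity μ p₀)
    (hf : Measurable f) (hf₀ : Measurable f₀) (hfn : ∀ x, 0 ≤ f x)
    (hf₀n : ∀ x, 0 ≤ f₀ x) (h1 : ∫⁻ x, ENNReal.ofReal (f x) ∂μ ≤ 1)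
    (h2 : ∫⁻ x, ENNReal.ofReal (f₀ x) ∂μ ≤ 1) {η : ℝ} (hη : 0 ≤ η) :
    ∫⁻ x, ENNReal.ofReal (√((f x + η * p₀ x) * f₀ x)) ∂μ
      ≤ ENNReal.ofReal (Real.exp (√η - hellingerSq μ f f₀ / 2)) := by
  obtain ⟨hA, hH⟩ := lintegral_sqrt_mul_le hf hf₀ hfn hf₀n h1 h2
  obtain ⟨hB, -⟩ := lintegral_sqrt_mul_le hp.measurable hf₀ hp.nonneg hf₀n hp.lintegral_eq_one.le h2
  have hBm : Measurable fun x => ENNReal.ofReal (√(p₀ x * f₀ x)) :=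
    (hp.measurable.mul hf₀).sqrt.ennreal_ofReal
  calc ∫⁻ x, ENNReal.ofReal (√((f x + η * p₀ x) * f₀ x)) ∂μ
      ≤ ∫⁻ x, (ENNReal.ofReal (√(f x * f₀ x))
          + ENNReal.ofReal (√η) * ENNReal.ofReal (√(p₀ x * f₀ x))) ∂μ := by
        refine lintegral_mono fun x => ?_
        rw [← ENNReal.ofReal_mul (Real.sqrt_nonneg _), ← ENNReal.ofReal_add (Real.sqrt_nonneg _)
          (by positivity), ← Real.sqrt_mul hη, add_mul, mul_assoc]
        exact ENNReal.ofReal_le_ofReal ((sqrt_add_le_add_sqrt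
          (mul_nonneg (hfn x) (hf₀n x)) (mul_nonneg hη (mul_nonneg (hp.nonneg x) (hf₀n x)))))
    _ = ∫⁻ x, ENNReal.ofReal (√(f x * f₀ x)) ∂μ
          + ENNReal.ofReal (√η) * ∫⁻ x, ENNReal.ofReal (√(p₀ x * f₀ x)) ∂μ := by
        rw [lintegral_add_left (by fun_prop),
          lintegral_const_mul _ hBm]
    _ ≤ ENNReal.ofReal (1 - hellingerSq μ f f₀ / 2) + ENNReal.ofReal (√η) * 1 := by
        gcongr
        refine hB.trans (ENNReal.ofReal_le_one.2 ?_)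
        linarith [hellingerSq_nonneg μ p₀ f₀]
    _ ≤ _ := by
        rw [mul_one, ← ENNReal.ofReal_add (by linarith) (Real.sqrt_nonneg _)]
        exact ENNReal.ofReal_le_ofReal
          (by linarith [Real.add_one_le_exp (√η - hellingerSq μ f f₀ / 2)])

end Hellinger

/-! ### Chernoff bound for likelihood ratios -/

section LikelihoodRatio

variable {μ : Measure ℝ} {f₀ h : ℝ → ℝ}

lemma ae_pos_densityMeasure (hf₀ : Measurable f₀) : ∀ᵐ x ∂(densityMeasure μ f₀), 0 < f₀ x := by
  rw [densityMeasure, ae_withDensity_iff hf₀.ennreal_ofReal]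
  exact .of_forall fun x hx => by simpa using hx

lemma lintegral_sqrt_div_densityMeasure_le (hf₀ : Measurable f₀) (hh : Measurable h)
    (hf₀n : ∀ x, 0 ≤ f₀ x) :
    ∫⁻ x, ENNReal.ofReal (√(h x / f₀ x)) ∂(densityMeasure μ f₀)
      ≤ ∫⁻ x, ENNReal.ofReal (√(h x * f₀ x)) ∂μ := by
  have hm : Measurable fun x => ENNReal.ofReal (√(h x / f₀ x)) :=
    (hh.div hf₀).sqrt.ennreal_ofReal
  rw [densityMeasure, lintegral_withDensity_eq_lintegral_mul _ hf₀.ennreal_ofReal hm]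
  refine lintegral_mono fun x => ?_
  rw [Pi.mul_apply, ← ENNReal.ofReal_mul (hf₀n x)]
  refine ENNReal.ofReal_le_ofReal ?_
  rcases (hf₀n x).eq_or_lt with h0 | h0
  · simp [← h0]
  · refine le_of_eq ?_
    nth_rw 1 [← Real.sqrt_sq h0.le]
    rw [← Real.sqrt_mul (sq_nonneg _)]
    congr 1
    field_simp

/-- Markov's inequality for `∏ √(h / f₀)`, whose expectation factorizes by independence. No
normalization of `h` is needed, so it applies to `f_g' + η p₀`. -/
lemma measure_likelihood_le {n : ℕ} (hf₀ : Measurable f₀) (hh : Measurable h)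
    (hf₀n : ∀ x, 0 ≤ f₀ x) (hhn : ∀ x, 0 ≤ h x) [IsProbabilityMeasure (densityMeasure μ f₀)]
    (Δ : ℝ) :
    (Measure.pi fun _ : Fin n => densityMeasure μ f₀)
        {x | (∀ i, 0 < f₀ (x i)) ∧ Real.exp (-Δ) * ∏ i, f₀ (x i) ≤ ∏ i, h (x i)}
      ≤ ENNReal.ofReal (Real.exp (Δ / 2))
          * (∫⁻ x, ENNReal.ofReal (√(h x * f₀ x)) ∂μ) ^ n := by
  set Q := densityMeasure μ f₀
  have hF : Measurable fun x => ENNReal.ofReal (√(h x / f₀ x)) :=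
    (hh.div hf₀).sqrt.ennreal_ofReal
  have hind : iIndepFun (fun (i : Fin n) (x : Fin n → ℝ) => ENNReal.ofReal (√(h (x i) / f₀ (x i))))
      (Measure.pi fun _ : Fin n => Q) :=
    iIndepFun_pi (X := fun _ x => ENNReal.ofReal (√(h x / f₀ x))) fun _ => hF.aemeasurable
  have hmarg : ∀ i : Fin n, ∫⁻ x, ENNReal.ofReal (√(h (x i) / f₀ (x i)))
      ∂(Measure.pi fun _ : Fin n => Q) = ∫⁻ x, ENNReal.ofReal (√(h x / f₀ x)) ∂Q := fun i =>
    (measurePreserving_eval (fun _ : Fin n => Q) i).lintegral_comp hF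
  have hprod : ∫⁻ x, ∏ i, ENNReal.ofReal (√(h (x i) / f₀ (x i)))
      ∂(Measure.pi fun _ : Fin n => Q) ≤ (∫⁻ x, ENNReal.ofReal (√(h x * f₀ x)) ∂μ) ^ n := by
    rw [lintegral_prod_eq_prod_lintegral_of_indepFun _ _ hind
      fun i => hF.comp (measurable_pi_apply i)]
    simp_rw [hmarg]
    rw [Finset.prod_const, Finset.card_univ, Fintype.card_fin]
    exact pow_le_pow_left' (lintegral_sqrt_div_densityMeasure_le hf₀ hh hf₀n) n
  have hsub : {x : Fin n → ℝ | (∀ i, 0 < f₀ (x i)) ∧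
      Real.exp (-Δ) * ∏ i, f₀ (x i) ≤ ∏ i, h (x i)} ⊆
      {x | ENNReal.ofReal (Real.exp (-Δ / 2)) ≤ ∏ i, ENNReal.ofReal (√(h (x i) / f₀ (x i)))} := by
    rintro x ⟨hx, hle⟩
    rw [Set.mem_ofPred_eq, ← ENNReal.ofReal_prod_of_nonneg fun i _ => Real.sqrt_nonneg _]
    refine ENNReal.ofReal_le_ofReal ?_
    rw [← Real.sqrt_prod _ fun i _ => div_nonneg (hhn _) (hf₀n _), Finset.prod_div_distrib]
    refine Real.le_sqrt_of_sq_le ?_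
    rw [← Real.exp_nat_mul, le_div_iff₀ (Finset.prod_pos fun i _ => hx i)]
    rwa [show ((2 : ℕ) : ℝ) * (-Δ / 2) = -Δ by push_cast; ring]
  have hm := mul_meas_ge_le_lintegral (μ := Measure.pi fun _ : Fin n => Q)
    (Finset.univ.measurable_prod fun i _ => hF.comp (measurable_pi_apply i))
    (ENNReal.ofReal (Real.exp (-Δ / 2)))
  have hone : ENNReal.ofReal (Real.exp (Δ / 2)) * ENNReal.ofReal (Real.exp (-Δ / 2)) = 1 := by
    rw [← ENNReal.ofReal_mul (Real.exp_pos _).le, ← Real.exp_add]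
    simp [neg_div]
  calc _ ≤ _ := measure_mono hsub
    _ = ENNReal.ofReal (Real.exp (Δ / 2)) * (ENNReal.ofReal (Real.exp (-Δ / 2)) *
          (Measure.pi fun _ : Fin n => Q) {x | ENNReal.ofReal (Real.exp (-Δ / 2)) ≤
            ∏ i, ENNReal.ofReal (√(h (x i) / f₀ (x i)))}) := by
        rw [← mul_assoc, hone, one_mul]
    _ ≤ _ := by
        gcongr
        refine le_trans ?_ hprod
        simpa [Finset.prod_apply] using hm

end LikelihoodRatio

/-! ### Entropy of mixtures through moments -/

section Entropy

/-- In the tail `k ≥ D`, each term may be multiplied by `exp (k - D) ≥ 1`; the result is dominated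
by the full series at `e B`. -/
lemma exp_sub_sum_le_exp (B : ℝ) (hB : 0 ≤ B) (D : ℕ) :
    Real.exp B - ∑ k ∈ Finset.range D, B ^ k / k.factorial
      ≤ Real.exp (Real.exp 1 * B - D) := by
  have hs : ∀ y : ℝ, HasSum (fun k : ℕ => y ^ k / k.factorial) (Real.exp y) := fun y => by
    rw [Real.exp_eq_exp_ℝ]
    exact NormedSpace.expSeries_div_hasSum_exp y
  have h3 : HasSum (fun k : ℕ => if k ∈ Finset.range D then B ^ k / k.factorial else 0)
      (∑ k ∈ Finset.range D, B ^ k / k.factorial) := by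
    have : HasSum (fun k : ℕ => if k ∈ Finset.range D then B ^ k / (k.factorial : ℝ) else 0)
        (∑ k ∈ Finset.range D, if k ∈ Finset.range D then B ^ k / (k.factorial : ℝ) else 0) :=
      hasSum_sum_of_ne_finset_zero fun b hb => by simp only [hb, if_false]
    rwa [Finset.sum_congr rfl fun k hk => if_pos hk] at this
  have h2 := (hs (Real.exp 1 * B)).mul_left (Real.exp (-D))
  rw [← Real.exp_add, neg_add_eq_sub] at h2
  refine hasSum_le (fun k => ?_) ((hs B).sub h3) h2
  by_cases hk : k < D
  · simp only [Finset.mem_range, hk, if_true, sub_self]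
    positivity
  · simp only [Finset.mem_range, hk, if_false, sub_zero]
    rw [mul_pow, ← Real.exp_nat_mul, mul_one, mul_div_assoc, ← mul_assoc, ← Real.exp_add]
    refine le_mul_of_one_le_left (by positivity) (Real.one_le_exp ?_)
    have : (D : ℝ) ≤ k := by exact_mod_cast not_lt.1 hk
    linarith

lemma abs_exp_sub_sum_le {y B : ℝ} (hy : |y| ≤ B) (D : ℕ) :
    |Real.exp y - ∑ k ∈ Finset.range D, y ^ k / k.factorial|
      ≤ Real.exp (Real.exp 1 * B - D) := by
  have h := Complex.norm_exp_sub_sum_le_exp_norm_sub_sum (y : ℂ) D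
  have hcast : Complex.exp y - ∑ m ∈ Finset.range D, (y : ℂ) ^ m / m.factorial
      = ((Real.exp y - ∑ k ∈ Finset.range D, y ^ k / k.factorial : ℝ) : ℂ) := by
    push_cast; rfl
  rw [hcast, Complex.norm_real, Complex.norm_real, Real.norm_eq_abs, Real.norm_eq_abs] at h
  refine h.trans ((exp_sub_sum_le_exp |y| (abs_nonneg y) D).trans (Real.exp_le_exp.2 ?_))
  gcongr

variable {μ : Measure ℝ} {p₀ : ℝ → ℝ}

/-- The scaled moments of `exp (-κ) dg`, which are the Taylor coefficients of `f_g / p₀`. -/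
noncomputable def scaledMoment (μ : Measure ℝ) (p₀ : ℝ → ℝ) (T : ℝ) (g : ProbabilityMeasure ℝ)
    (k : ℕ) : ℝ :=
  ∫ θ, (θ / T) ^ k * Real.exp (-cumulant μ p₀ θ) ∂(g : Measure ℝ)

lemma norm_scaledMoment_integrand_le (hd : IsProbDensity μ p₀)
    (h : canonicalSpace μ p₀ = Set.univ) (h0 : ∫ x, x * p₀ x ∂μ = 0) {T θ : ℝ} (hT : 0 < T)
    (hθ : |θ| ≤ T) (k : ℕ) : ‖(θ / T) ^ k * Real.exp (-cumulant μ p₀ θ)‖ ≤ 1 := by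
  rw [norm_mul, norm_pow, Real.norm_eq_abs, Real.norm_eq_abs, Real.abs_exp, abs_div, abs_of_pos hT]
  refine mul_le_one₀ (pow_le_one₀ (by positivity) ((div_le_one hT).2 hθ)) (Real.exp_pos _).le ?_
  exact Real.exp_le_one_iff.2 (neg_nonpos.2 (cumulant_nonneg hd h h0 θ))

lemma integrable_scaledMoment (hd : IsProbDensity μ p₀)
    (h : canonicalSpace μ p₀ = Set.univ) (h0 : ∫ x, x * p₀ x ∂μ = 0) {T : ℝ} (hT : 0 < T)
    {g : ProbabilityMeasure ℝ} (hg : ∀ᵐ θ ∂(g : Measure ℝ), |θ| ≤ T) (k : ℕ) :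
    Integrable (fun θ => (θ / T) ^ k * Real.exp (-cumulant μ p₀ θ)) (g : Measure ℝ) := by
  have hκ := cumulant_measurable h
  refine Integrable.of_bound (by fun_prop) 1 ?_
  filter_upwards [hg] with θ hθ using norm_scaledMoment_integrand_le hd h h0 hT hθ k

lemma abs_scaledMoment_le_one (hd : IsProbDensity μ p₀)
    (h : canonicalSpace μ p₀ = Set.univ) (h0 : ∫ x, x * p₀ x ∂μ = 0) {T : ℝ} (hT : 0 < T)
    {g : ProbabilityMeasure ℝ} (hg : ∀ᵐ θ ∂(g : Measure ℝ), |θ| ≤ T) (k : ℕ) :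
    |scaledMoment μ p₀ T g k| ≤ 1 := by
  have := norm_integral_le_of_norm_le_const
    (hg.mono fun θ hθ => norm_scaledMoment_integrand_le hd h h0 hT hθ k)
  simpa [scaledMoment] using this

lemma integrable_mixtureRatio (hd : IsProbDensity μ p₀)
    (h : canonicalSpace μ p₀ = Set.univ) (h0 : ∫ x, x * p₀ x ∂μ = 0) {T : ℝ}
    {g : ProbabilityMeasure ℝ} (hg : ∀ᵐ θ ∂(g : Measure ℝ), |θ| ≤ T) (x : ℝ) :
    Integrable (fun θ => Real.exp (θ * x - cumulant μ p₀ θ)) (g : Measure ℝ) := by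
  have hκ := cumulant_measurable h
  refine Integrable.of_bound (by fun_prop) (Real.exp (T * |x|)) ?_
  filter_upwards [hg] with θ hθ
  rw [Real.norm_eq_abs, Real.abs_exp, Real.exp_le_exp]
  have h1 : θ * x ≤ T * |x| := (le_abs_self _).trans (by rw [abs_mul]; gcongr)
  linarith [cumulant_nonneg hd h h0 θ]

lemma mixtureRatio_pos (hd : IsProbDensity μ p₀)
    (h : canonicalSpace μ p₀ = Set.univ) (h0 : ∫ x, x * p₀ x ∂μ = 0) {T : ℝ}
    {g : ProbabilityMeasure ℝ} (hg : ∀ᵐ θ ∂(g : Measure ℝ), |θ| ≤ T) (x : ℝ) :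
    0 < mixtureRatio μ p₀ g x :=
  integral_exp_pos (integrable_mixtureRatio hd h h0 hg x)

lemma abs_mixtureRatio_sub_sum_le (hd : IsProbDensity μ p₀)
    (h : canonicalSpace μ p₀ = Set.univ) (h0 : ∫ x, x * p₀ x ∂μ = 0) {M T : ℝ} (hT : 0 < T)
    {g : ProbabilityMeasure ℝ} (hg : ∀ᵐ θ ∂(g : Measure ℝ), |θ| ≤ T) (D : ℕ)
    {x : ℝ} (hx : |x| ≤ M) :
    |mixtureRatio μ p₀ g x
        - ∑ k ∈ Finset.range D, (T * x) ^ k / k.factorial * scaledMoment μ p₀ T g k|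
      ≤ Real.exp (Real.exp 1 * (M * T) - D) := by
  have hi : ∀ k ∈ Finset.range D, Integrable (fun θ => (T * x) ^ k / k.factorial *
      ((θ / T) ^ k * Real.exp (-cumulant μ p₀ θ))) (g : Measure ℝ) :=
    fun k _ => (integrable_scaledMoment hd h h0 hT hg k).const_mul _
  have hsum : ∑ k ∈ Finset.range D, (T * x) ^ k / k.factorial * scaledMoment μ p₀ T g k
      = ∫ θ, ∑ k ∈ Finset.range D, (T * x) ^ k / k.factorial *
          ((θ / T) ^ k * Real.exp (-cumulant μ p₀ θ)) ∂(g : Measure ℝ) := by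
    rw [integral_finsetSum _ hi]
    simp_rw [integral_const_mul, scaledMoment]
  rw [hsum, mixtureRatio, ← integral_sub (integrable_mixtureRatio hd h h0 hg x)
    (integrable_finsetSum _ hi), ← Real.norm_eq_abs]
  have hb : ∀ᵐ θ ∂(g : Measure ℝ), ‖Real.exp (θ * x - cumulant μ p₀ θ) -
      ∑ k ∈ Finset.range D, (T * x) ^ k / k.factorial *
          ((θ / T) ^ k * Real.exp (-cumulant μ p₀ θ))‖ ≤ Real.exp (Real.exp 1 * (M * T) - D) := by
    filter_upwards [hg] with θ hθ
    have hy : |θ * x| ≤ M * T := by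
      rw [abs_mul, mul_comm M]; gcongr
    have heq : Real.exp (θ * x - cumulant μ p₀ θ) -
        ∑ k ∈ Finset.range D, (T * x) ^ k / k.factorial *
          ((θ / T) ^ k * Real.exp (-cumulant μ p₀ θ))
        = (Real.exp (θ * x) - ∑ k ∈ Finset.range D, (θ * x) ^ k / k.factorial)
          * Real.exp (-cumulant μ p₀ θ) := by
      rw [sub_mul, Finset.sum_mul, sub_eq_add_neg (θ * x), Real.exp_add]
      congr 1
      refine Finset.sum_congr rfl fun k _ => ?_
      rw [div_pow, mul_pow, mul_pow]
      have := pow_pos hT k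
      field_simp
    rw [heq, norm_mul, Real.norm_eq_abs, Real.norm_eq_abs, Real.abs_exp]
    refine (mul_le_of_le_one_right (abs_nonneg _) (Real.exp_le_one_iff.2
      (neg_nonpos.2 (cumulant_nonneg hd h h0 θ)))).trans (abs_exp_sub_sum_le hy D)
  simpa using norm_integral_le_of_norm_le_const hb

lemma exists_finite_coloring (hd : IsProbDensity μ p₀)
    (h : canonicalSpace μ p₀ = Set.univ) (h0 : ∫ x, x * p₀ x ∂μ = 0) {M T η : ℝ} (hM : 0 ≤ M)
    (hT : 0 < T) (hη : 0 < η) (hη1 : η ≤ 1) :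
    ∃ (D R : ℕ) (c : ProbabilityMeasure ℝ → Fin D → Fin R),
      (R : ℝ) ^ D ≤ Real.exp ((4 * (M * T + Real.log (1 / η) + 1)) ^ 2) ∧
      ∀ g g' : ProbabilityMeasure ℝ, (∀ᵐ θ ∂(g : Measure ℝ), |θ| ≤ T) →
        (∀ᵐ θ ∂(g' : Measure ℝ), |θ| ≤ T) → c g = c g' →
        ∀ x : ℝ, |x| ≤ M → |mixtureRatio μ p₀ g x - mixtureRatio μ p₀ g' x| ≤ η := by
  set B := M * T with hBdef
  have hB : 0 ≤ B := by positivity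
  set l := Real.log (1 / η) with hl
  have hl0 : 0 ≤ l := Real.log_nonneg (by rw [le_div_iff₀ hη]; linarith)
  have hel : Real.exp l = 1 / η := Real.exp_log (by positivity)
  -- Rounding errors are weighted by at most `∑ B ^ k / k! ≤ exp B`, so they total at most `η / 2`.
  set δ := η * Real.exp (-B) / 2 with hδ
  have hδ0 : 0 < δ := by positivity
  -- Each Taylor remainder is at most `exp (-l - 2) ≤ η / 4`; two of them use the other `η / 2`.
  set D := ⌈Real.exp 1 * B + l + 2⌉₊ with hD
  -- The `min` only makes the colour defined for every `g`; it is inactive once `g` lives on `[-T,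
  -- T]`.
  refine ⟨D, ⌊2 / δ⌋₊ + 1, fun g k =>
    ⟨min ⌊(scaledMoment μ p₀ T g k + 1) / δ⌋₊ ⌊2 / δ⌋₊, by omega⟩, ?_, ?_⟩
  · have he : Real.exp 1 ≤ 3 := Real.exp_one_lt_three.le
    have hDle : (D : ℝ) ≤ 4 * (B + l + 1) := by
      have := (Nat.ceil_lt_add_one (a := Real.exp 1 * B + l + 2) (by positivity)).le
      nlinarith
    have hR : ((⌊2 / δ⌋₊ + 1 : ℕ) : ℝ) ≤ Real.exp (4 * (B + l + 1)) := by
      have h1 : 2 / δ = 4 * Real.exp (B + l) := by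
        rw [hδ, Real.exp_add, hel, Real.exp_neg]
        field_simp; norm_num
      have h2 := Nat.floor_le (a := 2 / δ) (by positivity)
      have h3 : (1 : ℝ) ≤ Real.exp (B + l) := Real.one_le_exp (by positivity)
      have h4 : (5 : ℝ) ≤ Real.exp 4 := by linarith [Real.add_one_le_exp (4 : ℝ)]
      have h5 : Real.exp (B + l + 4) ≤ Real.exp (4 * (B + l + 1)) :=
        Real.exp_le_exp.2 (by linarith)
      rw [Real.exp_add] at h5
      push_cast
      nlinarith
    calc ((⌊2 / δ⌋₊ + 1 : ℕ) : ℝ) ^ D ≤ Real.exp (4 * (B + l + 1)) ^ D := by gcongr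
      _ = Real.exp (D * (4 * (B + l + 1))) := (Real.exp_nat_mul _ _).symm
      _ ≤ _ := Real.exp_le_exp.2 (by rw [sq]; gcongr)
  · intro g g' hg hg' hc x hx
    have hτ : Real.exp (Real.exp 1 * B - D) ≤ η / 4 := by
      have h1 : Real.exp 1 * B - D ≤ -l - 2 := by
        have := Nat.le_ceil (Real.exp 1 * B + l + 2)
        linarith
      refine (Real.exp_le_exp.2 h1).trans ?_
      rw [Real.exp_sub, Real.exp_neg, hel, one_div, inv_inv]
      have h2 : (4 : ℝ) ≤ Real.exp 2 := by
        have := Real.exp_one_gt_d9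
        have h3 : Real.exp 2 = Real.exp 1 * Real.exp 1 := by rw [← Real.exp_add]; norm_num
        nlinarith
      gcongr
    have hmom : ∀ k ∈ Finset.range D,
        |scaledMoment μ p₀ T g k - scaledMoment μ p₀ T g' k| ≤ δ := by
      intro k hk
      have hck := congrArg Fin.val (congrFun hc ⟨k, Finset.mem_range.1 hk⟩)
      simp only at hck
      have ha := abs_le.1 (abs_scaledMoment_le_one hd h h0 hT hg k)
      have ha' := abs_le.1 (abs_scaledMoment_le_one hd h h0 hT hg' k)
      rw [min_eq_left (Nat.floor_le_floor (by gcongr; linarith)),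
        min_eq_left (Nat.floor_le_floor (by gcongr; linarith))] at hck
      have e1 := Nat.floor_le (a := (scaledMoment μ p₀ T g k + 1) / δ)
        (div_nonneg (by linarith) hδ0.le)
      have e2 := Nat.lt_floor_add_one ((scaledMoment μ p₀ T g k + 1) / δ)
      have e3 := Nat.floor_le (a := (scaledMoment μ p₀ T g' k + 1) / δ)
        (div_nonneg (by linarith) hδ0.le)
      have e4 := Nat.lt_floor_add_one ((scaledMoment μ p₀ T g' k + 1) / δ)
      rw [hck] at e1 e2
      have e5 : |(scaledMoment μ p₀ T g k - scaledMoment μ p₀ T g' k) / δ| ≤ 1 := by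
        have : (scaledMoment μ p₀ T g k - scaledMoment μ p₀ T g' k) / δ
          = (scaledMoment μ p₀ T g k + 1) / δ - (scaledMoment μ p₀ T g' k + 1) / δ := by ring
        rw [this, abs_le]
        constructor <;> linarith
      rwa [abs_div, abs_of_pos hδ0, div_le_one hδ0] at e5
    have hsum : |∑ k ∈ Finset.range D, (T * x) ^ k / k.factorial * scaledMoment μ p₀ T g k
        - ∑ k ∈ Finset.range D, (T * x) ^ k / k.factorial * scaledMoment μ p₀ T g' k|
        ≤ η / 2 := by
      rw [← Finset.sum_sub_distrib]
      calc _ ≤ ∑ k ∈ Finset.range D, B ^ k / k.factorial * δ := by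
            refine (Finset.abs_sum_le_sum_abs _ _).trans (Finset.sum_le_sum fun k hk => ?_)
            rw [← mul_sub, abs_mul, abs_div, abs_pow, abs_mul, abs_of_pos hT, Nat.abs_cast,
              hBdef, mul_comm M T]
            gcongr
            exact hmom k hk
        _ = (∑ k ∈ Finset.range D, B ^ k / k.factorial) * δ := (Finset.sum_mul _ _ _).symm
        _ ≤ Real.exp B * δ := by
            gcongr
            exact Real.sum_le_exp_of_nonneg hB D
        _ = η / 2 := by
            rw [hδ, Real.exp_neg]
            field_simp
    have t1 := abs_le.1 (abs_mixtureRatio_sub_sum_le hd h h0 hT hg D hx)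
    have t2 := abs_le.1 (abs_mixtureRatio_sub_sum_le hd h h0 hT hg' D hx)
    have t3 := abs_le.1 hsum
    rw [← hBdef] at t1 t2
    rw [abs_le]
    constructor <;> linarith

end Entropy

/-! ### Union bound and choice of exponents -/

section DeviationBound

variable {μ : Measure ℝ} {p₀ : ℝ → ℝ}

lemma measure_hellinger_deviation_le (hd : IsProbDensity μ p₀)
    (h : canonicalSpace μ p₀ = Set.univ) (h0 : ∫ x, x * p₀ x ∂μ = 0) (g₀ : ProbabilityMeasure ℝ)
    [IsProbabilityMeasure (densityMeasure μ (mixtureDensity μ p₀ g₀))] {n : ℕ} (hn : 1 ≤ n)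
    {M T Δ E : ℝ} (hM : 0 ≤ M) (hT : 0 < T) :
    (Measure.pi fun _ : Fin n => densityMeasure μ (mixtureDensity μ p₀ g₀))
      {x | (∀ i, 0 < mixtureDensity μ p₀ g₀ (x i)) ∧ (∀ i, |x i| ≤ M) ∧
        ∃ g : ProbabilityMeasure ℝ, (∀ᵐ θ ∂(g : Measure ℝ), |θ| ≤ T) ∧
          E ≤ hellingerSq μ (mixtureDensity μ p₀ g) (mixtureDensity μ p₀ g₀) ∧
          Real.exp (-Δ) * ∏ i, mixtureDensity μ p₀ g₀ (x i)
            ≤ ∏ i, mixtureDensity μ p₀ g (x i)}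
      ≤ ENNReal.ofReal (Real.exp
          ((4 * (M * T + 2 * Real.log n + 1)) ^ 2 + (Δ / 2 + 1 - n * E / 2))) := by
  have hn0 : (0 : ℝ) < n := by exact_mod_cast hn
  have hn1 : (1 : ℝ) ≤ n := by exact_mod_cast hn
  -- Then `n √η = 1`, while `log (1 / η)` is only `2 log n`.
  set η : ℝ := (1 / n) ^ 2 with hη
  have hη0 : 0 < η := by positivity
  have hη1 : η ≤ 1 := pow_le_one₀ (by positivity) (by rw [div_le_one hn0]; exact hn1)
  have hηl : Real.log (1 / η) = 2 * Real.log n := by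
    rw [hη, one_div_pow, one_div_one_div, Real.log_pow]; norm_num
  obtain ⟨D, R, c, hcard, hc⟩ := exists_finite_coloring hd h h0 hM hT hη0 hη1
  rw [hηl] at hcard
  have hmeas := mixtureDensity_measurable hd h
  have hnn := mixtureDensity_nonneg (μ := μ) hd
  have hone := lintegral_mixtureDensity_le_one hd h
  have hcell : ∀ a : Fin D → Fin R,
      (Measure.pi fun _ : Fin n => densityMeasure μ (mixtureDensity μ p₀ g₀))
      {x | (∀ i, 0 < mixtureDensity μ p₀ g₀ (x i)) ∧ (∀ i, |x i| ≤ M) ∧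
        ∃ g : ProbabilityMeasure ℝ, c g = a ∧ (∀ᵐ θ ∂(g : Measure ℝ), |θ| ≤ T) ∧
          E ≤ hellingerSq μ (mixtureDensity μ p₀ g) (mixtureDensity μ p₀ g₀) ∧
          Real.exp (-Δ) * ∏ i, mixtureDensity μ p₀ g₀ (x i)
            ≤ ∏ i, mixtureDensity μ p₀ g (x i)}
      ≤ ENNReal.ofReal (Real.exp (Δ / 2 + 1 - n * E / 2)) := by
    intro a
    by_cases hex : ∃ g : ProbabilityMeasure ℝ, c g = a ∧ (∀ᵐ θ ∂(g : Measure ℝ), |θ| ≤ T) ∧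
        E ≤ hellingerSq μ (mixtureDensity μ p₀ g) (mixtureDensity μ p₀ g₀)
    -- The representative is itself taken far from `f₀`, so no triangle inequality is needed.
    · obtain ⟨g', hg'a, hg'T, hg'E⟩ := hex
      calc _ ≤ (Measure.pi fun _ : Fin n => densityMeasure μ (mixtureDensity μ p₀ g₀))
            {x | (∀ i, 0 < mixtureDensity μ p₀ g₀ (x i)) ∧
              Real.exp (-Δ) * ∏ i, mixtureDensity μ p₀ g₀ (x i)
                ≤ ∏ i, (mixtureDensity μ p₀ g' (x i) + η * p₀ (x i))} := by
            refine measure_mono ?_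
            rintro x ⟨hpos, hxM, g, hga, hgT, -, hle⟩
            refine ⟨hpos, hle.trans (Finset.prod_le_prod (fun i _ => hnn g _) fun i _ => ?_)⟩
            have hclose := (abs_le.1 (hc g g' hgT hg'T (hga.trans hg'a.symm) (x i) (hxM i))).2
            rw [mixtureDensity_eq, mixtureDensity_eq, ← add_mul]
            exact mul_le_mul_of_nonneg_right (by linarith) (hd.nonneg _)
        _ ≤ ENNReal.ofReal (Real.exp (Δ / 2)) * (∫⁻ x, ENNReal.ofReal
              (√((mixtureDensity μ p₀ g' x + η * p₀ x) * mixtureDensity μ p₀ g₀ x)) ∂μ) ^ n :=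
            measure_likelihood_le (hmeas g₀) ((hmeas g').add (hd.measurable.const_mul η)) (hnn g₀)
              (fun x => add_nonneg (hnn g' x) (mul_nonneg hη0.le (hd.nonneg x))) Δ
        _ ≤ ENNReal.ofReal (Real.exp (Δ / 2)) * (ENNReal.ofReal (Real.exp (√η -
              hellingerSq μ (mixtureDensity μ p₀ g') (mixtureDensity μ p₀ g₀) / 2))) ^ n :=
            mul_le_mul_right (pow_le_pow_left' (lintegral_sqrt_add_mul_le hd (hmeas g') (hmeas g₀)
              (hnn g') (hnn g₀) (hone g') (hone g₀) hη0.le) n) _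
        _ ≤ _ := by
            rw [← ENNReal.ofReal_pow (Real.exp_pos _).le, ← ENNReal.ofReal_mul (Real.exp_pos _).le,
              ← Real.exp_nat_mul, ← Real.exp_add]
            refine ENNReal.ofReal_le_ofReal (Real.exp_le_exp.2 ?_)
            have h1 : (n : ℝ) * √η = 1 := by
              rw [hη, Real.sqrt_sq (by positivity)]; field_simp
            have h2 := mul_le_mul_of_nonneg_left hg'E hn0.le
            rw [mul_sub, h1]
            linarith
    · refine (measure_mono_null ?_ measure_empty).trans_le (zero_le)
      rintro x ⟨-, -, g, hga, hgT, hgE, -⟩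
      exact hex ⟨g, hga, hgT, hgE⟩
  calc _ ≤ (Measure.pi fun _ : Fin n => densityMeasure μ (mixtureDensity μ p₀ g₀))
        (⋃ a : Fin D → Fin R, {x | (∀ i, 0 < mixtureDensity μ p₀ g₀ (x i)) ∧ (∀ i, |x i| ≤ M) ∧
          ∃ g : ProbabilityMeasure ℝ, c g = a ∧ (∀ᵐ θ ∂(g : Measure ℝ), |θ| ≤ T) ∧
          E ≤ hellingerSq μ (mixtureDensity μ p₀ g) (mixtureDensity μ p₀ g₀) ∧
          Real.exp (-Δ) * ∏ i, mixtureDensity μ p₀ g₀ (x i)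
            ≤ ∏ i, mixtureDensity μ p₀ g (x i)}) := by
        refine measure_mono ?_
        rintro x ⟨hpos, hxM, g, hg⟩
        exact Set.mem_iUnion.2 ⟨c g, hpos, hxM, g, rfl, hg⟩
    _ ≤ ∑ a : Fin D → Fin R, ENNReal.ofReal (Real.exp (Δ / 2 + 1 - n * E / 2)) :=
        (measure_iUnion_fintype_le _ _).trans (Finset.sum_le_sum fun a _ => hcell a)
    _ = ENNReal.ofReal ((R : ℝ) ^ D) * ENNReal.ofReal (Real.exp (Δ / 2 + 1 - n * E / 2)) := by
        rw [Finset.sum_const, Finset.card_univ, nsmul_eq_mul, Fintype.card_fun, Fintype.card_fin,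
          Fintype.card_fin, ← ENNReal.ofReal_natCast]
        push_cast; rfl
    _ ≤ _ := by
        rw [Real.exp_add, ENNReal.ofReal_mul (Real.exp_pos _).le]
        gcongr

lemma two_mul_max_le_gammaZero {α₁ α₂ β₀ : ℝ} (hα₁ : 0 < α₁) (hα₂ : 0 < α₂) (hβ₀ : 0 < β₀) :
    2 * max ((1 + α₁) / β₀) 1 ≤ gammaZero α₁ α₂ β₀ := by
  have : 0 < min α₂ 1 := lt_min hα₂ one_pos
  unfold gammaZero
  have : 0 ≤ α₁ / (2 * β₀) * (1 + 1 / min α₂ 1) := by positivity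
  linarith

lemma gammaOne_pos {α₁ α₂ β₀ : ℝ} (hα₁ : 0 < α₁) (hβ₀ : 0 < β₀) : 0 < gammaOne α₁ α₂ β₀ :=
  lt_min (div_pos hβ₀ (lt_max_of_lt_left (by linarith))) one_pos

lemma gammaOne_mul_le {α₁ α₂ β₀ : ℝ} (hα₁ : 0 < α₁) (hβ₀ : 0 < β₀) :
    gammaOne α₁ α₂ β₀ * ((1 + α₁) / β₀) ≤ 1 / 2 := by
  have h1 : gammaOne α₁ α₂ β₀ ≤ β₀ / (4 * (1 + α₁)) :=
    (min_le_left _ _).trans (div_le_div_of_nonneg_left hβ₀.le (by linarith) (le_max_left _ _))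
  calc _ ≤ β₀ / (4 * (1 + α₁)) * ((1 + α₁) / β₀) := by gcongr
    _ = 1 / 4 := by field_simp
    _ ≤ _ := by norm_num

/-- Here `M T = A₂ M ^ (1 + α₁)`. The choice of `γ₁` keeps the power of `t` at most `1 / 2`, so that
the squared product is linear in `t`. -/
lemma truncation_product_le {A₂ b₁ α₁ α₂ β₀ t L : ℝ} (hα₁ : 0 < α₁) (hβ₀ : 0 < β₀) (hA₂ : 0 < A₂)
    (hb₁ : 0 < b₁) (ht : 1 ≤ t) (hL : 1 ≤ L) :
    (2 * (t ^ gammaOne α₁ α₂ β₀ * L) / b₁) ^ (1 / β₀) *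
        (A₂ * ((2 * (t ^ gammaOne α₁ α₂ β₀ * L) / b₁) ^ (1 / β₀)) ^ α₁)
      ≤ A₂ * (2 / b₁) ^ ((1 + α₁) / β₀) * (√t * L ^ max ((1 + α₁) / β₀) 1) := by
  have ht0 : 0 < t := by linarith
  have hL0 : 0 < L := by linarith
  set s := t ^ gammaOne α₁ α₂ β₀ with hs
  have hs0 : 0 < s := Real.rpow_pos_of_pos ht0 _
  set y := 2 * (s * L) / b₁ with hy
  have hy0 : 0 < y := by positivity
  have h1 : y ^ (1 / β₀) * (A₂ * (y ^ (1 / β₀)) ^ α₁) = A₂ * y ^ ((1 + α₁) / β₀) := by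
    rw [← Real.rpow_mul hy0.le, mul_left_comm, ← Real.rpow_add hy0]
    congr 2; field_simp
  have h2 : y = 2 / b₁ * (s * L) := by rw [hy]; ring
  have h3 : s ^ ((1 + α₁) / β₀) ≤ √t := by
    rw [hs, ← Real.rpow_mul ht0.le, Real.sqrt_eq_rpow]
    exact Real.rpow_le_rpow_of_exponent_le ht (gammaOne_mul_le hα₁ hβ₀)
  have h4 : L ^ ((1 + α₁) / β₀) ≤ L ^ max ((1 + α₁) / β₀) 1 :=
    Real.rpow_le_rpow_of_exponent_le hL (le_max_left _ _)
  rw [h1, h2, Real.mul_rpow (by positivity) (by positivity), Real.mul_rpow hs0.le hL0.le,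
    ← mul_assoc A₂]
  gcongr

/-- All terms are compared with `t L ^ γ₀`. As `C` enters halved, `32 (K + 3) ^ 2` pays for the
entropy, `A₁` for the likelihood tolerance, and `4` for the terms `1` and `s L`. -/
lemma entropy_exponent_le {K B A₁ C α₁ α₂ β₀ t L : ℝ} (hα₁ : 0 < α₁) (hα₂ : 0 < α₂) (hβ₀ : 0 < β₀)
    (hA₁ : 0 < A₁) (hK : 0 ≤ K) (hB : 0 ≤ B) (ht : 1 ≤ t) (hL : 1 ≤ L)
    (hBK : B ≤ K * (√t * L ^ max ((1 + α₁) / β₀) 1)) (hC : 32 * (K + 3) ^ 2 + A₁ + 4 ≤ C) :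
    (4 * (B + 2 * L + 1)) ^ 2 + (A₁ * L ^ gammaZero α₁ α₂ β₀ / 2 + 1
        - t * C * L ^ gammaZero α₁ α₂ β₀ / 2)
      ≤ -(t ^ gammaOne α₁ α₂ β₀) * L := by
  have ht0 : 0 < t := by linarith
  have hL0 : 0 < L := by linarith
  set m := max ((1 + α₁) / β₀) 1
  have hm1 : 1 ≤ m := le_max_right _ _
  set G := L ^ gammaZero α₁ α₂ β₀
  have hG : L ^ (2 * m) ≤ G :=
    Real.rpow_le_rpow_of_exponent_le hL (two_mul_max_le_gammaZero hα₁ hα₂ hβ₀)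
  have hLm : L ≤ L ^ m := by
    simpa using Real.rpow_le_rpow_of_exponent_le hL hm1
  have hst : 1 ≤ √t := Real.one_le_sqrt.2 ht
  have hsq : (√t * L ^ m) ^ 2 ≤ t * G := by
    rw [mul_pow, Real.sq_sqrt ht0.le, ← Real.rpow_natCast (L ^ m), ← Real.rpow_mul hL0.le,
      mul_comm m]
    gcongr
    exact hG
  have hLle : L ≤ √t * L ^ m := by nlinarith
  have hLG : L ≤ G := by
    refine le_trans ?_ hG
    simpa using Real.rpow_le_rpow_of_exponent_le hL (show (1 : ℝ) ≤ 2 * m by linarith)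
  have hs : t ^ gammaOne α₁ α₂ β₀ ≤ t := by
    simpa using Real.rpow_le_rpow_of_exponent_le ht
      (show gammaOne α₁ α₂ β₀ ≤ 1 from min_le_right _ _)
  have hsL : t ^ gammaOne α₁ α₂ β₀ * L ≤ t * G := by gcongr
  have h1 : (4 * (B + 2 * L + 1)) ^ 2 ≤ 16 * (K + 3) ^ 2 * (t * G) := by
    calc (4 * (B + 2 * L + 1)) ^ 2 ≤ (4 * ((K + 3) * (√t * L ^ m))) ^ 2 := by
          gcongr
          linarith
      _ = 16 * (K + 3) ^ 2 * (√t * L ^ m) ^ 2 := by ring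
      _ ≤ _ := by gcongr
  have hG1 : 1 ≤ G := hL.trans hLG
  have htG : G ≤ t * G := le_mul_of_one_le_left (by linarith) ht
  have h2 := mul_le_mul_of_nonneg_right hC (show 0 ≤ t * G by linarith)
  have h3 := mul_le_mul_of_nonneg_left htG hA₁.le
  linarith

end DeviationBound

/-! ### Approximate likelihood maximizers -/

section ApproximateMaximizer

variable {μ : Measure ℝ} {p₀ : ℝ → ℝ}

lemma abs_le_maxAbs {n : ℕ} (x : Fin n → ℝ) (i : Fin n) : |x i| ≤ maxAbs x :=
  le_ciSup (f := fun i => |x i|) (Set.finite_range _).bddAbove i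

/-- The maximizer beats `g₀`. Positivity must be checked before exponentiating, since `Real.log 0 =
0`; `f₀ > 0` forces `p₀ > 0` at the data. -/
lemma IsApproxNPMLE.exp_neg_mul_prod_le (hd : IsProbDensity μ p₀)
    (h : canonicalSpace μ p₀ = Set.univ) (h0 : ∫ x, x * p₀ x ∂μ = 0) {n : ℕ} {x : Fin n → ℝ}
    {Δ T : ℝ} {g g₀ : ProbabilityMeasure ℝ} (hg : IsApproxNPMLE μ p₀ x Δ g)
    (hT : ∀ᵐ θ ∂(g : Measure ℝ), |θ| ≤ T) (hpos : ∀ i, 0 < mixtureDensity μ p₀ g₀ (x i)) :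
    Real.exp (-Δ) * ∏ i, mixtureDensity μ p₀ g₀ (x i) ≤ ∏ i, mixtureDensity μ p₀ g (x i) := by
  obtain ⟨ĝ, hĝ, hle⟩ := hg
  have hgpos : ∀ i, 0 < mixtureDensity μ p₀ g (x i) := by
    intro i
    have hp : 0 < p₀ (x i) := by
      refine (hd.nonneg _).lt_of_ne fun h' => ?_
      have := hpos i
      rw [mixtureDensity_eq, ← h', mul_zero] at this
      exact this.false
    rw [mixtureDensity_eq]
    exact mul_pos (mixtureRatio_pos hd h h0 hT _) hp
  have hlog : ∀ f : ℝ → ℝ, (∀ i, 0 < f (x i)) → ∏ i, f (x i) = Real.exp (logLik x f) := by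
    intro f hf
    rw [logLik, Real.exp_sum]
    exact Finset.prod_congr rfl fun i _ => (Real.exp_log (hf i)).symm
  rw [hlog _ hpos, hlog _ hgpos, ← Real.exp_add, Real.exp_le_exp]
  linarith [hĝ g₀]

end ApproximateMaximizer

/-! ### Truncation and conclusion -/

theorem mainTheorem4 (μ : Measure ℝ) (p₀ : ℝ → ℝ) (g₀ : ProbabilityMeasure ℝ)
    (α₁ α₂ β₀ A₁ A₂ : ℝ)
    (hS2 : ScenarioS2 μ p₀ α₁ α₂) (hLT : LightTail μ p₀ g₀ β₀)
    (hA₁ : 0 < A₁) (hA₂ : 0 < A₂) :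
    ∃ C : ℝ, 0 < C ∧
      ∀ (n : ℕ), C ≤ n →
      ∀ (Ω : Type*) [MeasurableSpace Ω] (P : Measure Ω) [IsProbabilityMeasure P]
        (X : Fin n → Ω → ℝ) (gtilde : Ω → ProbabilityMeasure ℝ),
        (∀ i, HasLaw (X i) (densityMeasure μ (mixtureDensity μ p₀ g₀)) P) →
        iIndepFun X P →
        (∀ᵐ ω ∂P, IsApproxNPMLE μ p₀ (fun i => X i ω)
          (A₁ * Real.log n ^ gammaZero α₁ α₂ β₀) (gtilde ω)) →
        (∀ᵐ ω ∂P, ∀ θ ∈ (gtilde ω : Measure ℝ).support,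
          |θ| ≤ A₂ * maxAbs (fun i => X i ω) ^ α₁) →
        ∀ t : ℝ, 1 ≤ t →
          P.real {ω | t * C * (Real.log n ^ gammaZero α₁ α₂ β₀ / n) ≤
              hellingerSq μ (mixtureDensity μ p₀ (gtilde ω)) (mixtureDensity μ p₀ g₀)} ≤
            3 * Real.exp (-(t ^ gammaOne α₁ α₂ β₀) * Real.log n) := by
  have hd := hS2.density
  have hcan := hS2.canonicalSpace_eq
  have h0 := hS2.mean_zero
  have hα₂ := hS2.alpha₂_pos
  have hα₁ : 0 < α₁ := hα₂.trans_le hS2.alpha₂_le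
  obtain ⟨hβ₀, b₀, b₁, hb₀, hb₁, htail⟩ := hLT
  set K := A₂ * (2 / b₁) ^ ((1 + α₁) / β₀) with hK
  have hK0 : 0 ≤ K := by positivity
  have hexp := Real.exp_pos (b₁ * b₀ ^ β₀ / 2)
  -- For `n ≥ C`, the `4` also gives `L ≥ 1`, and the exponential ensures `M ≥ b₀`, where the tail
  -- bound applies.
  refine ⟨32 * (K + 3) ^ 2 + A₁ + 4 + Real.exp (b₁ * b₀ ^ β₀ / 2), by positivity, ?_⟩
  set C := 32 * (K + 3) ^ 2 + A₁ + 4 + Real.exp (b₁ * b₀ ^ β₀ / 2) with hC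
  intro n hn Ω _ P _ X gtilde hlaw hind happrox hsupp t ht
  set f₀ := mixtureDensity μ p₀ g₀ with hf₀
  set Q := densityMeasure μ f₀ with hQ
  have hC4 : 4 + Real.exp (b₁ * b₀ ^ β₀ / 2) ≤ C := by
    have : 0 ≤ 32 * (K + 3) ^ 2 := by positivity
    linarith
  have hn1 : (1 : ℝ) ≤ n := by linarith
  have hn0 : (0 : ℝ) < n := by linarith
  have hnN : 1 ≤ n := by exact_mod_cast hn1
  set L := Real.log n with hL
  have hL1 : 1 ≤ L := by
    rw [hL, Real.le_log_iff_exp_le hn0]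
    linarith [Real.exp_one_lt_three]
  have hLb : b₁ * b₀ ^ β₀ / 2 ≤ L := by
    rw [hL, Real.le_log_iff_exp_le hn0]
    linarith
  have hQp : IsProbabilityMeasure Q := (hlaw ⟨0, hnN⟩).isProbabilityMeasure_iff.1 inferInstance
  set s := t ^ gammaOne α₁ α₂ β₀ with hs
  have hs1 : 1 ≤ s := Real.one_le_rpow ht (gammaOne_pos hα₁ hβ₀).le
  -- With this level `n exp (-b₁ M ^ β₀) = exp (L - 2 s L) ≤ exp (-s L)`.
  set M := (2 * (s * L) / b₁) ^ (1 / β₀) with hM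
  have hM0 : 0 < M := by positivity
  have hMpow : M ^ β₀ = 2 * (s * L) / b₁ := by
    rw [hM, ← Real.rpow_mul (by positivity), one_div_mul_cancel hβ₀.ne', Real.rpow_one]
  have hsL : L ≤ s * L := le_mul_of_one_le_left (by linarith) hs1
  have hMb : b₀ ≤ M := by
    rw [← Real.rpow_le_rpow_iff hb₀.le hM0.le hβ₀, hMpow, le_div_iff₀ hb₁]
    linarith
  have hT0 : 0 < A₂ * M ^ α₁ := by positivity
  have hlarge : (Measure.pi fun _ : Fin n => Q) {x | M ≤ maxAbs x}
      ≤ ENNReal.ofReal (Real.exp (-s * L)) := by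
    rw [← ofReal_measureReal]
    refine ENNReal.ofReal_le_ofReal ((htail n M hMb).trans ?_)
    rw [hMpow, ← Real.exp_log hn0, ← Real.exp_add, Real.exp_le_exp, ← hL]
    have : -b₁ * (2 * (s * L) / b₁) = -(2 * (s * L)) := by field_simp
    rw [this]
    linarith
  have hdev := measure_hellinger_deviation_le hd hcan h0 g₀ hnN (M := M) (T := A₂ * M ^ α₁)
    (Δ := A₁ * L ^ gammaZero α₁ α₂ β₀) (E := t * C * (L ^ gammaZero α₁ α₂ β₀ / n)) hM0.le hT0
  set S := {x : Fin n → ℝ | (∀ i, 0 < f₀ (x i)) ∧ (∀ i, |x i| ≤ M) ∧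
        ∃ g : ProbabilityMeasure ℝ, (∀ᵐ θ ∂(g : Measure ℝ), |θ| ≤ A₂ * M ^ α₁) ∧
          t * C * (L ^ gammaZero α₁ α₂ β₀ / n) ≤ hellingerSq μ (mixtureDensity μ p₀ g) f₀ ∧
          Real.exp (-(A₁ * L ^ gammaZero α₁ α₂ β₀)) * ∏ i, f₀ (x i)
            ≤ ∏ i, mixtureDensity μ p₀ g (x i)} with hS
  have hsmall : (Measure.pi fun _ : Fin n => Q) S ≤ ENNReal.ofReal (Real.exp (-s * L)) := by
    refine hdev.trans (ENNReal.ofReal_le_ofReal (Real.exp_le_exp.2 ?_))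
    have := entropy_exponent_le (B := M * (A₂ * M ^ α₁)) (C := C) hα₁ hα₂ hβ₀ hA₁ hK0
      (by positivity) ht hL1
      (truncation_product_le (α₂ := α₂) hα₁ hβ₀ hA₂ hb₁ ht hL1) (by linarith)
    refine le_trans (le_of_eq ?_) this
    congr 2
    field_simp
  have hXm : AEMeasurable (fun ω i => X i ω) P :=
    aemeasurable_pi_lambda _ fun i => (hlaw i).aemeasurable
  have hmap : P.map (fun ω i => X i ω) = Measure.pi fun _ : Fin n => Q := by
    rw [hind.map_fun_eq_pi_map fun i => (hlaw i).aemeasurable]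
    simp_rw [(hlaw _).map_eq]
  have hpos : ∀ᵐ ω ∂P, ∀ i, 0 < f₀ (X i ω) := by
    rw [ae_all_iff]
    intro i
    have hae := ae_pos_densityMeasure (μ := μ) (mixtureDensity_measurable hd hcan g₀)
    rw [← hf₀, ← hQ, ← (hlaw i).map_eq] at hae
    exact ae_of_ae_map (hlaw i).aemeasurable hae
  have hP : P {ω | t * C * (L ^ gammaZero α₁ α₂ β₀ / n) ≤
      hellingerSq μ (mixtureDensity μ p₀ (gtilde ω)) f₀}
      ≤ ENNReal.ofReal (2 * Real.exp (-s * L)) := by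
    calc _ ≤ P ((fun ω i => X i ω) ⁻¹' ({x | M ≤ maxAbs x} ∪ S)) := by
          refine measure_mono_ae ?_
          filter_upwards [happrox, hsupp, hpos] with ω hω hωs hωp hωH
          by_cases hmax : M ≤ maxAbs fun i => X i ω
          · exact Or.inl hmax
          · have hle : (maxAbs fun i => X i ω) ≤ M := (not_le.1 hmax).le
            have hnn : 0 ≤ maxAbs fun i => X i ω :=
              (abs_nonneg _).trans (abs_le_maxAbs (fun i => X i ω) ⟨0, hnN⟩)
            have hgT : ∀ᵐ θ ∂(gtilde ω : Measure ℝ), |θ| ≤ A₂ * M ^ α₁ := by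
              filter_upwards [Measure.support_mem_ae (μ := (gtilde ω : Measure ℝ))] with θ hθ
              refine (hωs θ hθ).trans ?_
              gcongr
            exact Or.inr ⟨hωp, fun i => (abs_le_maxAbs (fun i => X i ω) i).trans hle, gtilde ω,
              hgT, hωH, hω.exp_neg_mul_prod_le hd hcan h0 hgT hωp⟩
      -- This direction holds for arbitrary sets, so neither `S` nor `gtilde` has to be measurable.
      _ ≤ (P.map fun ω i => X i ω) ({x | M ≤ maxAbs x} ∪ S) := Measure.le_map_apply hXm _
      _ ≤ (Measure.pi fun _ : Fin n => Q) {x | M ≤ maxAbs x}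
            + (Measure.pi fun _ : Fin n => Q) S := by
          rw [hmap]
          exact measure_union_le _ _
      _ ≤ ENNReal.ofReal (Real.exp (-s * L)) + ENNReal.ofReal (Real.exp (-s * L)) :=
          add_le_add hlarge hsmall
      _ = _ := by
          rw [← ENNReal.ofReal_add (Real.exp_pos _).le (Real.exp_pos _).le, two_mul]
  refine (ENNReal.toReal_le_of_le_ofReal (by positivity) hP).trans ?_
  linarith [Real.exp_pos (-s * L)]
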